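/- Let $\mathbb{F}_q$ be the finite field with $q$ elements, and let $e,d$ be positive integers with $e>d$ and $q>d(2e-d+1)/2$. Let $g\in\mathbb{F}_q[T]$ be a fixed monic polynomial of degree $e$, and let $f$ be uniformly distributed among the $q^d$ monic polynomials of degree $d$ in $\mathbb{F}_q[T]$. Consider the Euclidean algorithm on input $(g,f)$: starting with $(a,b)=(g,f)$, as long as $b\neq 0$, divide $a$ by $b$ with remainder $r$ and replace $(a,b)$ by $(b,r)$. Each such polynomial division is performed by the classical synthetic division algorithm: if $a=\sum_{i\le m}u_iT^i$ and $b=\sum_{i\le n}v_iT^i$ have degrees $m\ge n$, then for $k=m-n,\dots,0$ one computes $c_k=u_{n+k}/v_n$ (one division in $\mathbb{F}_q$) and then, for $j=n-1,\dots,0$, replaces $u_{k+j}$ by $u_{k+j}-c_kv_j$ (one multiplication and one subtraction in $\mathbb{F}_q$ each); all these operations are performed and counted whatever the values of the coefficients. Let $t_g^{\sf div}(f)$, $t_g^{\div}(f)$, $t_g^{-}(f)$ and $t_g^{\times}(f)$ be the total numbers of polynomial divisions, and of divisions, subtractions and multiplications in $\mathbb{F}_q$, respectively, performed on input $(g,f)$,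 and let $E[\,\cdot\,]$ denote the expected value over $f$. Then $$\left|\frac{E[t_g^{\sf div}]}{d+1}-1\right|\le\frac{de}{q},\qquad \left|\frac{E[t_g^{\div}]}{e+d+1}-1\right|\le\frac{de}{q},$$ $$\left|\frac{E[t_g^{-}]}{de}-1\right|\le\frac{de}{q},\qquad \left|\frac{E[t_g^{\times}]}{de}-1\right|\le\frac{de}{q}.$$ -/

import Mathlib

open Polynomial
open scoped BigOperators

noncomputable section

namespace EuclidCost

/-- The kinds of operations whose number is counted: polynomial divisions, and divisions,
subtractions and multiplications in the coefficient field. -/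
inductive Op
  | polyDiv
  | div
  | sub
  | mul
  deriving DecidableEq

/-- A result together with the number of operations of each kind spent to obtain it. -/
structure Counted (α : Type*) where
  val : α
  cost : Op → ℕ

namespace Counted

/-- A result obtained at no cost. -/
protected def pure {α : Type*} (a : α) : Counted α := ⟨a, 0⟩

/-- Sequential composition: the costs add up. -/
protected def bind {α β : Type*} (x : Counted α) (f : α → Counted β) : Counted β :=
  ⟨(f x.val).val, x.cost + (f x.val).cost⟩

/-- A result obtained by a single operation of kind `w`. -/
def tick {α : Type*} (w : Op) (a : α) : Counted α := ⟨a, Pi.single w 1⟩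

instance : Monad Counted where
  pure := Counted.pure
  bind := Counted.bind

end Counted

open Counted

/-- Inner loop of synthetic division: for `j = n - 1, …, 0`, replace the register `u (k + j)` by
`u (k + j) - c * v j`. Each pass costs one multiplication and one subtraction. -/
def subLoop {F : Type*} [Field F] (c : F) (v : ℕ → F) (k : ℕ) :
    ℕ → (ℕ → F) → Counted (ℕ → F)
  | 0, u => pure u
  | j + 1, u => do
    let p ← tick Op.mul (c * v j)
    let s ← tick Op.sub (u (k + j) - p)
    subLoop c v k j (Function.update u (k + j) s)

/-- Outer loop of synthetic division by a polynomial with coefficients `v 0, …, v n`, `v n ≠ 0`.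
For `k = l - 1, …, 0`, compute the quotient coefficient `u (n + k) / v n` and subtract the
corresponding multiple of `v 0, …, v (n - 1)` from `u k, …, u (k + n - 1)`. The registers `u` hold
the dividend at the start and the remainder (below index `n`) at the end; the quotient coefficients
are collected in `w`. -/
def divLoop {F : Type*} [Field F] (v : ℕ → F) (n : ℕ) :
    ℕ → (ℕ → F) → (ℕ → F) → Counted ((ℕ → F) × (ℕ → F))
  | 0, w, u => pure (w, u)
  | k + 1, w, u => do
    let c ← tick Op.div (u (n + k) / v n)
    let u' ← subLoop c v k n u
    divLoop v n k (Function.update w k c) u'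

/-- The polynomial of degree less than `n` whose coefficients are `u 0, …, u (n - 1)`. -/
def ofCoeffs {F : Type*} [Field F] (n : ℕ) (u : ℕ → F) : F[X] :=
  ∑ i ∈ Finset.range n, C (u i) * X ^ i

/-- Synthetic division of `a` by `b ≠ 0`, returning quotient and remainder. With `m = deg a` and
`n = deg b`, the outer loop is run `m - n + 1` times if `m ≥ n`, and not at all if `m < n`. -/
def synthDiv {F : Type*} [Field F] (a b : F[X]) : Counted (F[X] × F[X]) :=
  let l := a.natDegree + 1 - b.natDegree
  do
    let r ← divLoop b.coeff b.natDegree l 0 a.coeff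
    return (ofCoeffs l r.1, ofCoeffs b.natDegree r.2)

theorem degree_ofCoeffs_lt {F : Type*} [Field F] (n : ℕ) (u : ℕ → F) :
    (ofCoeffs n u).degree < n := by
  rw [ofCoeffs, ← Polynomial.mem_degreeLT]
  refine Submodule.sum_mem _ fun i hi => ?_
  rw [Polynomial.mem_degreeLT]
  exact (degree_C_mul_X_pow_le i (u i)).trans_lt (by exact_mod_cast Finset.mem_range.1 hi)

theorem degree_synthDiv_lt {F : Type*} [Field F] (a b : F[X]) (hb : b ≠ 0) :
    (synthDiv a b).val.2.degree < b.degree := by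
  rw [degree_eq_natDegree hb]
  exact degree_ofCoeffs_lt _ _

open scoped Classical in
/-- The Euclidean algorithm: as long as `b ≠ 0`, divide `a` by `b` (one polynomial division, carried
out by synthetic division) and go on with `b` and the remainder. The result is the last nonzero
remainder, that is, a greatest common divisor of the inputs (not normalized). -/
def euclid {F : Type*} [Field F] (a b : F[X]) : Counted F[X] :=
  if hb : b = 0 then pure a
  else
    let s := synthDiv a b
    let t := euclid b s.val.2
    ⟨t.val, Pi.single Op.polyDiv 1 + s.cost + t.cost⟩
termination_by b.degree
decreasing_by exact degree_synthDiv_lt a b hb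

/-- `opCount w g f` is the number of operations of kind `w` performed by the Euclidean algorithm on
input `(g, f)`. -/
def opCount {F : Type*} [Field F] (w : Op) (g f : F[X]) : ℕ := (euclid g f).cost w

theorem finite_monic_natDegree_eq (F : Type*) [Field F] [Fintype F] (d : ℕ) :
    {f : F[X] | f.Monic ∧ f.natDegree = d}.Finite := by
  refine Set.Finite.of_finite_image (f := fun f : F[X] => fun i : Fin (d + 1) => f.coeff i)
    (Set.toFinite _) ?_
  rintro p ⟨-, hp⟩ q ⟨-, hq⟩ h
  ext i
  rcases Nat.lt_or_ge i (d + 1) with hi | hi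
  · exact congrFun h ⟨i, hi⟩
  · rw [coeff_eq_zero_of_natDegree_lt (by omega), coeff_eq_zero_of_natDegree_lt (by omega)]

/-- The finite set of monic polynomials of degree `d` over the finite field `F`. -/
def monicsOfDegree (F : Type*) [Field F] [Fintype F] (d : ℕ) : Finset F[X] :=
  (finite_monic_natDegree_eq F d).toFinset

/-- The expected number of operations of kind `w` performed by the Euclidean algorithm on input
`(g, f)`, for `f` uniformly distributed among the monic polynomials of degree `d`. -/
def expectedCount {F : Type*} [Field F] [Fintype F] (w : Op) (g : F[X]) (d : ℕ) : ℝ :=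
  Finset.expect (monicsOfDegree F d) fun f => (opCount w g f : ℝ)

end EuclidCost

end

/-!
For each kind of operation there is a value `M` (`EuclidCost.genericCost`) that is attained when
the successive remainders have degrees `d - 1, d - 2, …, 0`, without gaps, and is never exceeded, since gaps in the degree sequence only save operations (`EuclidCost.cost_euclid_le`,
`EuclidCost.cost_euclid_eq`). So the expectation lies between `M` times the probability that there
is no gap and `M`, and it is enough to show that gaps occur with probability at most `d * e / q`.

If the remainders skip the degree `k < d`, the cofactors of the extended Euclidean algorithm give a
nonzero `s` with `deg s < e - k` and `deg (s * f mod g) < k` (`EuclidCost.HasGap`). That is, the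
square matrix of the linear map sending `s` to the coefficients of `s * f mod g` in degrees
`k, …, e - 1` is singular. Replacing `f` by `f + a * X ^ k` adds `a` times the identity to this map,
because `s * X ^ k` needs no reduction modulo `g`. Hence for given values of the other coefficients
of `f`, at most `e - k` values of its coefficient at `X ^ k` allow a gap at `k`: they are determined
by the eigenvalues of an `(e - k) × (e - k)` matrix (`EuclidCost.HasGap.hasEigenvalue`). The gap at
`k` has probability at most `(e - k) / q`, and the sum over `k < d` is at most `d * e / q`.
-/

namespace EuclidCost

open Counted

/-! ### Cost and correctness of synthetic division -/

theorem Counted.val_bind {α β : Type _} (x : Counted α) (f : α → Counted β) :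
    (x >>= f).val = (f x.val).val := rfl

theorem Counted.cost_bind {α β : Type _} (x : Counted α) (f : α → Counted β) :
    (x >>= f).cost = x.cost + (f x.val).cost := rfl

theorem Counted.val_pure {α : Type _} (a : α) : (pure a : Counted α).val = a := rfl

theorem Counted.cost_pure {α : Type _} (a : α) : (pure a : Counted α).cost = 0 := rfl

theorem Counted.val_tick {α : Type _} (w : Op) (a : α) : (tick w a).val = a := rfl

theorem Counted.cost_tick {α : Type _} (w : Op) (a : α) :
    (tick w a).cost = Pi.single w 1 := rfl

/-- The number of operations of each kind in a synthetic division with `l` quotient coefficients by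
a polynomial of degree `n`. -/
def synthDivCost (l n : ℕ) : Op → ℕ
  | .polyDiv => 0
  | .div => l
  | .sub => l * n
  | .mul => l * n

section Field

variable {F : Type*} [Field F]

theorem cost_subLoop (c : F) (v : ℕ → F) (k j : ℕ) (u : ℕ → F) :
    (subLoop c v k j u).cost = j • (Pi.single Op.mul 1 + Pi.single Op.sub 1 : Op → ℕ) := by
  induction j generalizing u with
  | zero => simp [subLoop, Counted.cost_pure]
  | succ j ih =>
    rw [subLoop]
    simp only [Counted.cost_bind, Counted.cost_tick, ih, succ_nsmul]
    abel

theorem val_subLoop (c : F) (v : ℕ → F) (k j : ℕ) (u : ℕ → F) (i : ℕ) :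
    (subLoop c v k j u).val i = if k ≤ i ∧ i < k + j then u i - c * v (i - k) else u i := by
  induction j generalizing u with
  | zero =>
    rw [if_neg (by omega)]
    rfl
  | succ j ih =>
    rw [subLoop]
    simp only [Counted.val_bind, Counted.val_tick, ih, Function.update_apply]
    rcases lt_trichotomy i (k + j) with h | rfl | h
    · simp [h, h.ne, h.trans (Nat.lt_succ_self _), ← add_assoc]
    · simp
    · rw [if_neg (by omega), if_neg (by omega), if_neg (by omega)]

theorem cost_divLoop (v : ℕ → F) (n l : ℕ) (w u : ℕ → F) :
    (divLoop v n l w u).cost = synthDivCost l n := by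
  induction l generalizing w u with
  | zero => funext o; cases o <;> simp [divLoop, Counted.cost_pure, synthDivCost]
  | succ l ih =>
    rw [divLoop]
    simp only [Counted.cost_bind, Counted.cost_tick, ih, cost_subLoop]
    funext o
    cases o <;> simp [synthDivCost] <;> ring

theorem cost_synthDiv (a b : F[X]) :
    (synthDiv a b).cost = synthDivCost (a.natDegree + 1 - b.natDegree) b.natDegree := by
  simp only [synthDiv, Counted.cost_bind, Counted.cost_pure, cost_divLoop, add_zero]

theorem coeff_ofCoeffs (n : ℕ) (u : ℕ → F) (i : ℕ) :
    (ofCoeffs n u).coeff i = if i < n then u i else 0 := by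
  simp [ofCoeffs, coeff_C_mul, coeff_X_pow]

theorem ofCoeffs_coeff {a : F[X]} {n : ℕ} (h : a.natDegree < n) : ofCoeffs n a.coeff = a := by
  ext i
  rw [coeff_ofCoeffs]
  split_ifs with hi
  · rfl
  · rw [coeff_eq_zero_of_natDegree_lt (by omega)]

/-- The registers below index `n` left by the outer loop hold a remainder: only the registers below
`n + k` matter once the quotient coefficient `k` has been computed, so the fact that the leading
register is not reset to `0` is harmless. -/
theorem dvd_ofCoeffs_sub_divLoop {b : F[X]} (hb : b ≠ 0) (l : ℕ) (w u : ℕ → F) :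
    b ∣ ofCoeffs (b.natDegree + l) u -
      ofCoeffs b.natDegree (divLoop b.coeff b.natDegree l w u).val.2 := by
  induction l generalizing w u with
  | zero => simp [divLoop, Counted.val_pure]
  | succ k ih =>
    rw [divLoop]
    simp only [Counted.val_bind, Counted.val_tick]
    set c := u (b.natDegree + k) / b.coeff b.natDegree with hc
    set u' := (subLoop c b.coeff k b.natDegree u).val with hu'
    have step : ofCoeffs (b.natDegree + (k + 1)) u =
        C c * X ^ k * b + ofCoeffs (b.natDegree + k) u' := by
      ext i
      have hl : b.coeff b.natDegree ≠ 0 := leadingCoeff_ne_zero.mpr hb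
      rw [coeff_add, coeff_ofCoeffs, coeff_ofCoeffs, mul_assoc, coeff_C_mul, coeff_X_pow_mul',
        hu', val_subLoop]
      rcases lt_trichotomy i (b.natDegree + k) with h | rfl | h
      · rw [if_pos (by omega), if_pos h]
        by_cases hk : k ≤ i
        · rw [if_pos hk, if_pos (by omega)]; ring
        · rw [if_neg hk, if_neg (by omega)]; ring
      · rw [if_pos (by omega), if_pos (by omega), if_neg (by omega), Nat.add_sub_cancel, hc,
          div_mul_cancel₀ _ hl, add_zero]
      · rw [if_neg (by omega), if_pos (by omega), if_neg (by omega),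
          coeff_eq_zero_of_natDegree_lt (by omega)]
        ring
    rw [step, add_sub_assoc]
    exact dvd_add (dvd_mul_left _ _) (ih _ _)

theorem dvd_sub_synthDiv {a b : F[X]} (hb : b ≠ 0) (h : b.natDegree ≤ a.natDegree) :
    b ∣ a - (synthDiv a b).val.2 := by
  have := dvd_ofCoeffs_sub_divLoop hb (a.natDegree + 1 - b.natDegree) 0 a.coeff
  rwa [ofCoeffs_coeff (a := a) (by omega)] at this

/-! ### Operation counts of the Euclidean algorithm -/

theorem cost_euclid_zero (a : F[X]) : (euclid a 0).cost = 0 := by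
  rw [euclid, dif_pos rfl]
  rfl

theorem cost_euclid {a b : F[X]} (hb : b ≠ 0) :
    (euclid a b).cost = Pi.single Op.polyDiv 1 +
      synthDivCost (a.natDegree + 1 - b.natDegree) b.natDegree +
      (euclid b (synthDiv a b).val.2).cost := by
  rw [euclid, dif_neg hb]
  simp only [cost_synthDiv]

/-- The number of operations of each kind in the Euclidean algorithm on inputs of degrees
`m > n` whose successive remainders have degrees `n - 1, n - 2, …, 0`. -/
def genericCost (m n : ℕ) : Op → ℕ
  | .polyDiv => n + 1
  | .div => m + n + 1
  | .sub => n * m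
  | .mul => n * m

theorem genericCost_zero_right (m : ℕ) :
    genericCost m 0 = Pi.single Op.polyDiv 1 + synthDivCost (m + 1) 0 := by
  funext o
  cases o <;> simp [genericCost, synthDivCost]

theorem genericCost_succ_right {m n : ℕ} (h : n + 1 ≤ m) :
    genericCost m (n + 1) = Pi.single Op.polyDiv 1 + synthDivCost (m + 1 - (n + 1)) (n + 1) +
      genericCost (n + 1) n := by
  obtain ⟨t, rfl⟩ := Nat.exists_eq_add_of_le h
  rw [show n + 1 + t + 1 - (n + 1) = t + 1 by omega]
  funext o
  cases o <;> simp [genericCost, synthDivCost] <;> ring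

theorem genericCost_mono_right (m : ℕ) : Monotone (genericCost m) := by
  intro n n' h o
  cases o <;> simp only [genericCost] <;> gcongr

/-- Gaps in the degrees of the remainders can only lower the operation counts. -/
theorem cost_euclid_le {a b : F[X]} (hb : b ≠ 0) (h : b.natDegree < a.natDegree) :
    (euclid a b).cost ≤ genericCost a.natDegree b.natDegree := by
  induction hn : b.natDegree using Nat.strong_induction_on generalizing a b with
  | _ n ih =>
  subst hn
  rw [cost_euclid hb]
  by_cases hr : (synthDiv a b).val.2 = 0
  · rw [hr, cost_euclid_zero, add_zero]
    rcases Nat.eq_zero_or_pos b.natDegree with h0 | h0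
    · simp [h0, genericCost_zero_right]
    · obtain ⟨n, hn⟩ := Nat.exists_eq_succ_of_ne_zero h0.ne'
      rw [hn, Nat.succ_eq_add_one, genericCost_succ_right (by omega)]
      exact le_self_add
  · have hlt := natDegree_lt_natDegree hr (degree_synthDiv_lt a b hb)
    obtain ⟨n, hn⟩ := Nat.exists_eq_succ_of_ne_zero (Nat.ne_zero_of_lt hlt)
    rw [Nat.succ_eq_add_one] at hn
    have := ih _ hlt hr hlt rfl
    rw [hn] at this ⊢
    rw [genericCost_succ_right (by omega)]
    gcongr
    exact this.trans (genericCost_mono_right _ (by omega))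

/-- Some nonzero `s` with `deg s < deg g - k` has `s * f` congruent modulo `g` to a polynomial of
degree less than `k`. (This amounts to the vanishing of the `k`-th subresultant of `g` and `f`.) -/
def HasGap (g f : F[X]) (k : ℕ) : Prop :=
  ∃ s : F[X], s ≠ 0 ∧ s.natDegree + k < g.natDegree ∧ (s * f %ₘ g).degree < k

/-- A step `(a, b)` of the algorithm comes with cofactors `s' * f ≡ a` and `s * f ≡ b` modulo `g`,
where `deg s' < deg s = deg g - deg a`. If the next remainder has degree below `deg b - 1`, its
cofactor witnesses `HasGap g f (deg b - 1)`. -/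
theorem cost_euclid_eq {g f : F[X]} (hg : g.Monic) {a b s s' : F[X]} (hb : b ≠ 0)
    (h : b.natDegree < a.natDegree) (hgap : ∀ k < b.natDegree, ¬ HasGap g f k)
    (ha : g ∣ s' * f - a) (hb' : g ∣ s * f - b) (hs : s'.degree < s.degree)
    (hdeg : s.natDegree + a.natDegree = g.natDegree) :
    (euclid a b).cost = genericCost a.natDegree b.natDegree := by
  induction hn : b.natDegree generalizing a b s s' with
  | zero =>
    have hr : (synthDiv a b).val.2 = 0 := by
      have := degree_synthDiv_lt a b hb
      rw [degree_eq_natDegree hb, hn, Nat.cast_zero] at this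
      exact degree_eq_bot.mp (Nat.WithBot.lt_zero_iff.mp this)
    rw [cost_euclid hb, hr, cost_euclid_zero, add_zero, hn, genericCost_zero_right, Nat.sub_zero]
  | succ n ih =>
    have hrlt := degree_synthDiv_lt a b hb
    obtain ⟨q, hq⟩ := dvd_sub_synthDiv hb h.le
    rw [cost_euclid hb, hn, genericCost_succ_right (by omega)]
    set r := (synthDiv a b).val.2
    have hs0 : s ≠ 0 := by rintro rfl; simp at hs
    have ha0 : a ≠ 0 := by rintro rfl; simp at h
    have hba : b.degree < a.degree := by
      rw [degree_eq_natDegree hb, degree_eq_natDegree ha0]; exact_mod_cast h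
    have hqd : b.degree + q.degree = a.degree := by
      rw [← degree_mul, ← hq, degree_sub_eq_left_of_degree_lt (hrlt.trans hba)]
    have hq0 : q ≠ 0 := by
      rintro rfl
      simp only [degree_zero, WithBot.add_bot] at hqd
      exact ha0 (degree_eq_bot.mp hqd.symm)
    have hqn : b.natDegree + q.natDegree = a.natDegree := by
      rw [degree_eq_natDegree hb, degree_eq_natDegree ha0, degree_eq_natDegree hq0] at hqd
      exact_mod_cast hqd
    have hsq : s.degree < (q * s).degree := by
      rw [degree_mul, degree_eq_natDegree hq0, degree_eq_natDegree hs0]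
      exact_mod_cast (by omega : s.natDegree < q.natDegree + s.natDegree)
    have htd : (s' - q * s).degree = (q * s).degree :=
      degree_sub_eq_right_of_degree_lt (hs.trans hsq)
    have htn : (s' - q * s).natDegree = q.natDegree + s.natDegree := by
      rw [natDegree_eq_of_degree_eq htd, natDegree_mul hq0 hs0]
    have ht0 : s' - q * s ≠ 0 := by
      intro h0
      rw [h0, degree_zero] at htd
      exact mul_ne_zero hq0 hs0 (degree_eq_bot.mp htd.symm)
    have hdvd : g ∣ (s' - q * s) * f - r := by
      have : (s' - q * s) * f - r = (s' * f - a) - q * (s * f - b) := by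
        linear_combination hq
      rw [this]
      exact dvd_sub ha (hb'.mul_left q)
    have hrg : r.degree < g.degree := by
      refine hrlt.trans ?_
      rw [degree_eq_natDegree hb, degree_eq_natDegree hg.ne_zero]
      exact_mod_cast (by omega : b.natDegree < g.natDegree)
    have hmod : (s' - q * s) * f %ₘ g = r := by
      rw [← (modByMonic_eq_self_iff hg).mpr hrg]
      exact modByMonic_eq_of_dvd_sub hg hdvd
    have hnr : (n : WithBot ℕ) ≤ r.degree := by
      by_contra! hlt
      exact hgap n (by omega) ⟨_, ht0, by omega, hmod ▸ hlt⟩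
    have hr0 : r ≠ 0 := by
      rintro h0
      simp [h0] at hnr
    have hrn : r.natDegree = n := by
      apply le_antisymm
      · have := natDegree_lt_natDegree hr0 hrlt
        omega
      · exact le_natDegree_of_coe_le_degree hnr
    congr 1
    have := ih hr0 (by omega) (fun k hk => hgap k (by omega)) hb' hdvd (htd ▸ hsq) (by omega) hrn
    rw [this, hn]

theorem opCount_le (w : Op) {g f : F[X]} (hf : f ≠ 0) (h : f.natDegree < g.natDegree) :
    opCount w g f ≤ genericCost g.natDegree f.natDegree w :=
  cost_euclid_le hf h w

theorem opCount_eq (w : Op) {g f : F[X]} (hg : g.Monic) (hf : f ≠ 0)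
    (h : f.natDegree < g.natDegree) (hgap : ¬ ∃ k < f.natDegree, HasGap g f k) :
    opCount w g f = genericCost g.natDegree f.natDegree w := by
  push Not at hgap
  exact congrFun (cost_euclid_eq hg (s := 1) (s' := 0) hf h hgap (by simp) (by simp) (by simp)
    (by simp)) w

/-! ### Counting the exceptional inputs -/

/-- The linear endomorphism sending the coefficients of a polynomial `s` of degree less than `n` to
the coefficients of `s * f %ₘ g` at `k, …, k + n - 1`. -/
noncomputable def mulModCoeffs (g f : F[X]) (k n : ℕ) : Module.End F (Fin n → F) :=
  LinearMap.pi fun i => lcoeff F (k + i) ∘ₗ modByMonicHom g ∘ₗ LinearMap.mulRight F f ∘ₗ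
    (degreeLT F n).subtype ∘ₗ (degreeLTEquiv F n).symm.toLinearMap

theorem mulModCoeffs_apply (g f : F[X]) (k n : ℕ) (s : degreeLT F n) (i : Fin n) :
    mulModCoeffs g f k n (degreeLTEquiv F n s) i = ((s : F[X]) * f %ₘ g).coeff (k + i) := by
  simp [mulModCoeffs, modByMonicHom]

/-- As `s * X ^ k` has degree less than `deg g`, adding `a * X ^ k` to `f` adds `a` times the
identity to `mulModCoeffs g f`. A gap at `k` thus makes `-a` an eigenvalue. -/
theorem HasGap.hasEigenvalue {g f : F[X]} (hg : g.Monic) {k : ℕ} {a : F}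
    (h : HasGap g (f + C a * X ^ k) k) :
    (mulModCoeffs g f k (g.natDegree - k)).HasEigenvalue (-a) := by
  obtain ⟨s, hs0, hsd, hlt⟩ := h
  set n := g.natDegree - k with hn
  have hmem : s ∈ degreeLT F n := by
    rw [mem_degreeLT, degree_eq_natDegree hs0]
    exact_mod_cast (by omega : s.natDegree < n)
  refine Module.End.hasEigenvalue_of_hasEigenvector (x := degreeLTEquiv F n ⟨s, hmem⟩) ⟨?_, ?_⟩
  · rw [Module.End.mem_eigenspace_iff]
    funext i
    rw [mulModCoeffs_apply, Pi.smul_apply]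
    have hsX : (s * (C a * X ^ k)).degree < g.degree := by
      refine lt_of_le_of_lt degree_le_natDegree ?_
      rw [degree_eq_natDegree hg.ne_zero]
      have := natDegree_mul_le (p := s) (q := C a * X ^ k)
      have := natDegree_C_mul_X_pow_le a k
      exact_mod_cast (by omega)
    have h0 : (s * (f + C a * X ^ k) %ₘ g).coeff (k + i) = 0 :=
      coeff_eq_zero_of_degree_lt (hlt.trans_le (by exact_mod_cast Nat.le_add_right _ _))
    rw [mul_add, add_modByMonic, (modByMonic_eq_self_iff hg).mpr hsX, coeff_add, ← mul_assoc,
      add_comm k, coeff_mul_X_pow, coeff_mul_C] at h0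
    rw [add_comm k, eq_neg_of_add_eq_zero_left h0]
    simp [degreeLTEquiv, mul_comm]
  · intro h0
    rw [LinearEquiv.map_eq_zero_iff, Submodule.mk_eq_zero] at h0
    exact hs0 h0

end Field

variable {F : Type*} [Field F] [Fintype F]

open scoped Classical in
theorem card_filter_hasGap_le {g : F[X]} (hg : g.Monic) (f : F[X]) (k : ℕ) :
    (Finset.univ.filter fun a : F => HasGap g (f + C a * X ^ k) k).card ≤ g.natDegree - k := by
  set L := mulModCoeffs g f k (g.natDegree - k)
  calc _ ≤ L.charpoly.roots.toFinset.card := by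
        refine Finset.card_le_card_of_injOn (fun a => -a) (fun a ha => ?_) neg_injective.injOn
        simp only [Finset.coe_filter, Finset.mem_univ, true_and, Set.mem_ofPred_eq] at ha
        rw [Finset.mem_coe, Multiset.mem_toFinset, mem_roots L.charpoly_monic.ne_zero]
        exact (Module.End.hasEigenvalue_iff_isRoot_charpoly L _).mp (ha.hasEigenvalue hg)
    _ ≤ L.charpoly.natDegree := (Multiset.toFinset_card_le _).trans (card_roots' _)
    _ = _ := by rw [LinearMap.charpoly_natDegree, Module.finrank_fin_fun]

theorem mem_monicsOfDegree {d : ℕ} {f : F[X]} :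
    f ∈ monicsOfDegree F d ↔ f.Monic ∧ f.natDegree = d := by
  simp [monicsOfDegree]

theorem add_C_mul_X_pow_mem_monicsOfDegree {d k : ℕ} (hk : k < d) (a : F) {f : F[X]}
    (hf : f ∈ monicsOfDegree F d) : f + C a * X ^ k ∈ monicsOfDegree F d := by
  rw [mem_monicsOfDegree] at hf ⊢
  have hlt : (C a * X ^ k).degree < f.degree := by
    refine (degree_C_mul_X_pow_le k a).trans_lt ?_
    rw [degree_eq_natDegree hf.1.ne_zero, hf.2]
    exact_mod_cast hk
  exact ⟨hf.1.add_of_left hlt,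
    (natDegree_eq_of_degree_eq (degree_add_eq_left_of_degree_lt hlt)).trans hf.2⟩

open scoped Classical in
/-- Since each translation by `a * X ^ k` permutes the monic polynomials of degree `d > k`, the
bound on the number of bad `a` for each `f` bounds the proportion of bad `f`. -/
theorem card_mul_card_hasGap_le {g : F[X]} (hg : g.Monic) {d k : ℕ} (hk : k < d) :
    Fintype.card F * ((monicsOfDegree F d).filter fun f => HasGap g f k).card ≤
      (monicsOfDegree F d).card * (g.natDegree - k) := by
  have hshift (a : F) :
      ((monicsOfDegree F d).filter fun f => HasGap g f k).card ≤
        ((monicsOfDegree F d).filter fun f => HasGap g (f + C a * X ^ k) k).card := by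
    refine Finset.card_le_card_of_injOn (fun f => f + C (-a) * X ^ k) (fun f hf => ?_)
      (add_left_injective _).injOn
    simp only [Finset.coe_filter, Set.mem_ofPred_eq] at hf ⊢
    refine ⟨add_C_mul_X_pow_mem_monicsOfDegree hk _ hf.1, ?_⟩
    simpa using hf.2
  calc Fintype.card F * ((monicsOfDegree F d).filter fun f => HasGap g f k).card
      = ∑ _a : F, ((monicsOfDegree F d).filter fun f => HasGap g f k).card := by simp
    _ ≤ ∑ a : F, ((monicsOfDegree F d).filter fun f => HasGap g (f + C a * X ^ k) k).card :=
        Finset.sum_le_sum fun a _ => hshift a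
    _ = ∑ f ∈ monicsOfDegree F d,
          (Finset.univ.filter fun a : F => HasGap g (f + C a * X ^ k) k).card :=
        Finset.sum_card_bipartiteAbove_eq_sum_card_bipartiteBelow _
    _ ≤ (monicsOfDegree F d).card * (g.natDegree - k) :=
        Finset.sum_le_card_nsmul _ _ _ fun f _ => card_filter_hasGap_le hg f k

open scoped Classical in
theorem card_mul_card_exists_hasGap_le {g : F[X]} (hg : g.Monic) (d : ℕ) :
    Fintype.card F * ((monicsOfDegree F d).filter fun f => ∃ k < d, HasGap g f k).card ≤
      (monicsOfDegree F d).card * (d * g.natDegree) := by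
  have hsub : ((monicsOfDegree F d).filter fun f => ∃ k < d, HasGap g f k) ⊆
      (Finset.range d).biUnion fun k => (monicsOfDegree F d).filter fun f => HasGap g f k := by
    intro f
    simp only [Finset.mem_filter, Finset.mem_biUnion, Finset.mem_range]
    rintro ⟨hf, k, hk, hgap⟩
    exact ⟨k, hk, hf, hgap⟩
  calc _ ≤ Fintype.card F *
        ∑ k ∈ Finset.range d, ((monicsOfDegree F d).filter fun f => HasGap g f k).card := by
        gcongr
        exact (Finset.card_le_card hsub).trans Finset.card_biUnion_le
    _ = ∑ k ∈ Finset.range d,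
          Fintype.card F * ((monicsOfDegree F d).filter fun f => HasGap g f k).card :=
        Finset.mul_sum _ _ _
    _ ≤ ∑ _k ∈ Finset.range d, (monicsOfDegree F d).card * g.natDegree :=
        Finset.sum_le_sum fun k hk => (card_mul_card_hasGap_le hg (Finset.mem_range.mp hk)).trans
          (Nat.mul_le_mul_left _ (Nat.sub_le _ _))
    _ = _ := by
        rw [Finset.sum_const, Finset.card_range, smul_eq_mul]
        ring

theorem monicsOfDegree_nonempty (d : ℕ) : (monicsOfDegree F d).Nonempty :=
  ⟨X ^ d, mem_monicsOfDegree.mpr ⟨monic_X_pow d, natDegree_X_pow d⟩⟩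

/-! ### Expected operation counts -/

theorem abs_expectedCount_div_sub_one_le (w : Op) {g : F[X]} (hg : g.Monic) {d : ℕ}
    (hd : d < g.natDegree) (hpos : 0 < genericCost g.natDegree d w) :
    |expectedCount w g d / (genericCost g.natDegree d w : ℝ) - 1| ≤
      (d : ℝ) * (g.natDegree : ℝ) / (Fintype.card F : ℝ) := by
  classical
  set S := monicsOfDegree F d with hS
  set M := genericCost g.natDegree d w with hM
  set B := S.filter fun f => ∃ k < d, HasGap g f k with hB
  have hS0 : (0 : ℝ) < S.card := by exact_mod_cast (monicsOfDegree_nonempty d).card_pos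
  have hq0 : (0 : ℝ) < Fintype.card F := by exact_mod_cast Fintype.card_pos
  have hM0 : (0 : ℝ) < M := by exact_mod_cast hpos
  have hcard : (Fintype.card F : ℝ) * B.card ≤ S.card * (d * g.natDegree) := by
    exact_mod_cast card_mul_card_exists_hasGap_le hg d
  have hE : expectedCount w g d = (∑ f ∈ S, (opCount w g f : ℝ)) / S.card :=
    Finset.expect_eq_sum_div_card _ _
  have hupper : ∑ f ∈ S, (opCount w g f : ℝ) ≤ S.card * M := by
    rw [← nsmul_eq_mul]
    refine Finset.sum_le_card_nsmul _ _ _ fun f hf => ?_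
    obtain ⟨hf1, hf2⟩ := mem_monicsOfDegree.mp hf
    have := opCount_le w hf1.ne_zero (hf2 ▸ hd : f.natDegree < g.natDegree)
    rw [hf2] at this
    exact_mod_cast this
  have hlower : (S.card - B.card : ℝ) * M ≤ ∑ f ∈ S, (opCount w g f : ℝ) := by
    have hsplit := Finset.card_filter_add_card_filter_not (s := S)
      (fun f => ∃ k < d, HasGap g f k)
    have hsplit' : (S.card - B.card : ℝ) =
        (S.filter fun f => ¬ ∃ k < d, HasGap g f k).card := by
      rw [← hsplit]; push_cast; ring
    rw [hsplit', ← nsmul_eq_mul]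
    refine (Finset.card_nsmul_le_sum _ _ _ fun f hf => ?_).trans
      (Finset.sum_le_sum_of_subset_of_nonneg (Finset.filter_subset _ _)
        fun _ _ _ => Nat.cast_nonneg _)
    obtain ⟨hfS, hgap⟩ := Finset.mem_filter.mp hf
    obtain ⟨hf1, hf2⟩ := mem_monicsOfDegree.mp hfS
    have := opCount_eq w hg hf1.ne_zero (hf2 ▸ hd : f.natDegree < g.natDegree) (by rwa [hf2])
    rw [hf2] at this
    exact_mod_cast this.ge
  have hle : expectedCount w g d / M ≤ 1 := by
    rw [div_le_one hM0, hE, div_le_iff₀ hS0]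
    linarith
  have hge : 1 - (B.card : ℝ) / S.card ≤ expectedCount w g d / M := by
    rw [hE, le_div_iff₀ hM0, le_div_iff₀ hS0]
    calc (1 - (B.card : ℝ) / S.card) * M * S.card = (S.card - B.card : ℝ) * M := by
          field_simp
      _ ≤ _ := hlower
  have hB : (B.card : ℝ) / S.card ≤ d * g.natDegree / Fintype.card F := by
    rw [div_le_div_iff₀ hS0 hq0]
    linarith
  rw [abs_sub_comm, abs_of_nonneg (by linarith)]
  linarith

end EuclidCost

theorem mainTheorem1 {F : Type*} [Field F] [Fintype F] (e d : ℕ) (hd : 0 < d) (hde : d < e)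
    (hq : (d : ℝ) * (2 * (e : ℝ) - (d : ℝ) + 1) / 2 < (Fintype.card F : ℝ))
    (g : Polynomial F) (hg : g.Monic) (hge : g.natDegree = e) :
    |EuclidCost.expectedCount EuclidCost.Op.polyDiv g d / ((d : ℝ) + 1) - 1|
        ≤ (d : ℝ) * (e : ℝ) / (Fintype.card F : ℝ) ∧
    |EuclidCost.expectedCount EuclidCost.Op.div g d / ((e : ℝ) + (d : ℝ) + 1) - 1|
        ≤ (d : ℝ) * (e : ℝ) / (Fintype.card F : ℝ) ∧
    |EuclidCost.expectedCount EuclidCost.Op.sub g d / ((d : ℝ) * (e : ℝ)) - 1|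
        ≤ (d : ℝ) * (e : ℝ) / (Fintype.card F : ℝ) ∧
    |EuclidCost.expectedCount EuclidCost.Op.mul g d / ((d : ℝ) * (e : ℝ)) - 1|
        ≤ (d : ℝ) * (e : ℝ) / (Fintype.card F : ℝ) := by

  subst hge
  have key (w : EuclidCost.Op) (hw : 0 < EuclidCost.genericCost g.natDegree d w) :=
    EuclidCost.abs_expectedCount_div_sub_one_le w hg hde hw
  have hmul : 0 < d * g.natDegree := Nat.mul_pos hd (hd.trans hde)
  refine ⟨?_, ?_, ?_, ?_⟩
  · simpa [EuclidCost.genericCost] using key .polyDiv (Nat.succ_pos _)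
  · simpa [EuclidCost.genericCost] using key .div (Nat.succ_pos _)
  · simpa only [EuclidCost.genericCost, Nat.cast_mul] using key .sub hmul
  · simpa only [EuclidCost.genericCost, Nat.cast_mul] using key .mul hmul
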